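/- **Theorem (comparison).** Let $f:X\to Y$ be a continuous map of topological spaces, let $I=[0,1]$, and give path spaces $Z^I$ the compact-open topology. Let $M_f=\big((X\times I)\sqcup Y\big)/\big((x,1)\sim f(x)\big)$ be the mapping cylinder, in which $X$ is identified with the image of $x\mapsto[x,0]$. All invariants below are reduced, with values in $\{-1,0,1,\dots,\infty\}$ ($\infty$ if no such $k$ exists; $-1$ exactly when the set to be covered is empty). * $TC(f)$ (pullback TC) is the least $k$ such that $X\times X$ has an open cover $U_0,\dots,U_k$ with continuous maps $s_i:U_i\to Y^I$ satisfying $s_i(x_0,x_1)(0)=f(x_0)$ and $s_i(x_0,x_1)(1)=f(x_1)$. * $TC_Z(A)$, for a space $Z$ and $A\subseteq Z\times Z$, is the least $k$ such that $A$ is covered by sets $U_0,\dots,U_k$ open in $A$ with continuous maps $s_i:U_i\to Z^I$ satisfying $s_i(z_0,z_1)(0)=z_0$ and $s_i(z_0,z_1)(1)=z_1$. * $TC^{\mathrm{mix}}(f)$ (mixed TC) is the least $k$ such that $Y\times X$ has an open cover $U_0,\dots,U_k$ with continuous maps $s_i:U_i\to Y^I$ satisfying $s_i(y,x)(0)=y$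 and $s_i(y,x)(1)=f(x)$. * $TC(Z,A)$, for a pair $A\subseteq Z$ with inclusion $i$, is the sectional category (the least $k$ such that the base has an open cover $U_0,\dots,U_k$ with a continuous partial section over each $U_i$) of the pullback along $i\times \mathrm{Id}_Z:A\times Z\to Z\times Z$ of the path fibration $Z^I\to Z\times Z$, $\gamma\mapsto(\gamma(0),\gamma(1))$. * $TC^{\mathrm{rob}}(f)$ (Pavešić's robotic TC) is the least $k$ such that there are closed sets $\emptyset=C_{-1}\subseteq C_0\subseteq\dots\subseteq C_k=Y\times X$ for which the map $\pi_f:X^I\to Y\times X$, $\alpha\mapsto(f(\alpha(0)),\alpha(1))$, has a continuous partial section over each $C_i\setminus C_{i-1}$. Then $$TC(f)=TC_{M_f}(X\times X)\le TC^{\mathrm{mix}}(f)=TC(M_f,X).$$ If moreover $X$ is metrizable and $Y$ is an ANR (a metrizable space which, whenever it is embedded as a closed subset of a metrizable space, is a retract of an open neighbourhood of itself), in particular if $X$ and $Y$ are ANRs, then also $$TC(M_f,X)\le TC^{\mathrm{rob}}(f).$$ -/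

import Mathlib

open Set Topology unitInterval

namespace MapTC

universe u v

/-- The reduced value `k = n - 1` of a covering invariant, where `n` is the least number of pieces
with property `P`; it is `∞` if there is no such `n`, and `-1` if no piece at all is needed. -/
noncomputable def reducedLeast (P : ℕ → Prop) : EReal :=
  ⨅ (n : ℕ) (_ : P n), ((n : EReal) - 1)

/-- `p` admits a (continuous) partial section over the subset `Z` of the base. -/
def HasPartialSection {E B : Type*} [TopologicalSpace E] [TopologicalSpace B]
    (p : E → B) (Z : Set B) : Prop :=
  ∃ s : C(Z, E), ∀ z : Z, p (s z) = z

/-- Sectional category (reduced): the least `k` such that the base is covered by `k + 1` open sets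
admitting partial sections. -/
noncomputable def secat {E B : Type*} [TopologicalSpace E] [TopologicalSpace B]
    (p : E → B) : EReal :=
  reducedLeast fun n => ∃ U : Fin n → Set B,
    (∀ i, IsOpen (U i) ∧ HasPartialSection p (U i)) ∧ ⋃ i, U i = univ

/-- The path space fibration `Y^I → Y × Y`, `γ ↦ (γ 0, γ 1)`; the path space `C(I, Y)` has the
compact-open topology. -/
def pathFibration (Y : Type*) [TopologicalSpace Y] (γ : C(I, Y)) : Y × Y := (γ 0, γ 1)

section Maps

variable {X : Type u} {Y : Type v} [TopologicalSpace X] [TopologicalSpace Y]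

/-- There is an `f`-motion planner on `Z ⊆ X × X`. -/
def HasPlanner (f : C(X, Y)) (Z : Set (X × X)) : Prop :=
  ∃ s : C(Z, C(I, Y)), ∀ z : Z, s z 0 = f z.1.1 ∧ s z 1 = f z.1.2

/-- The pullback topological complexity of `f`. -/
noncomputable def pullTC (f : C(X, Y)) : EReal :=
  reducedLeast fun n => ∃ U : Fin n → Set (X × X),
    (∀ i, IsOpen (U i) ∧ HasPlanner f (U i)) ∧ ⋃ i, U i = univ

/-- There is a mixed `f`-motion planner on `Z ⊆ Y × X`. -/
def HasMixedPlanner (f : C(X, Y)) (Z : Set (Y × X)) : Prop :=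
  ∃ s : C(Z, C(I, Y)), ∀ z : Z, s z 0 = z.1.1 ∧ s z 1 = f z.1.2

/-- The mixed topological complexity of `f`. -/
noncomputable def mixedTC (f : C(X, Y)) : EReal :=
  reducedLeast fun n => ∃ U : Fin n → Set (Y × X),
    (∀ i, IsOpen (U i) ∧ HasMixedPlanner f (U i)) ∧ ⋃ i, U i = univ

/-- The map `π_f : X^I → Y × X`, `α ↦ (f (α 0), α 1)`. -/
def robotMap (f : C(X, Y)) (α : C(I, X)) : Y × X := (f (α 0), α 1)

/-- Robotic topological complexity of `f`: the least `k` for which there are closed sets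
`∅ = C_{-1} ⊆ C_0 ⊆ ... ⊆ C_k = Y × X` such that `π_f` has a partial section over each difference
`C_i \ C_{i-1}`. Below the indices are shifted by one, and `n = k + 1`. -/
noncomputable def robotTC (f : C(X, Y)) : EReal :=
  reducedLeast fun n => ∃ C : Fin (n + 1) → Set (Y × X),
    (∀ i, IsClosed (C i)) ∧ Monotone C ∧ C 0 = ∅ ∧ C (Fin.last n) = univ ∧
    ∀ i : Fin n, HasPartialSection (robotMap f) (C i.succ \ C i.castSucc)

end Maps

section Relative

variable {X : Type u} [TopologicalSpace X]

/-- The relative topological complexity `TC_X(A)` of a subset `A ⊆ X × X`: covers of `A` by sets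
open in `A` with motion planners whose paths run in `X`. -/
noncomputable def relTC (A : Set (X × X)) : EReal :=
  reducedLeast fun n => ∃ U : Fin n → Set A,
    (∀ i, IsOpen (U i) ∧
      ∃ s : C(U i, C(I, X)), ∀ z : U i, s z 0 = z.1.1.1 ∧ s z 1 = z.1.1.2) ∧
    ⋃ i, U i = univ

/-- The relative topological complexity `TC(X, A)` of a pair `A ⊆ X`: the sectional category of the
pullback of the path space fibration of `X` along `incl × id : A × X → X × X`. -/
noncomputable def pairTC (A : Set X) : EReal :=
  secat (Function.Pullback.fst :
    Function.Pullback (Prod.map (Subtype.val : A → X) (id : X → X)) (pathFibration X) → A × X)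

end Relative

section Cylinder

variable {X : Type u} {Y : Type v} [TopologicalSpace X] [TopologicalSpace Y]

/-- The gluing `(x, 1) ∼ f x` on `(X × I) ⊔ Y`. -/
inductive CylRel (f : C(X, Y)) : (X × I) ⊕ Y → (X × I) ⊕ Y → Prop
  | glue (x : X) : CylRel f (Sum.inl (x, 1)) (Sum.inr (f x))

/-- The mapping cylinder `M_f`, with the quotient topology. -/
def MappingCylinder (f : C(X, Y)) : Type (max u v) := Quot (CylRel f)

instance (f : C(X, Y)) : TopologicalSpace (MappingCylinder f) :=
  inferInstanceAs (TopologicalSpace (Quot (CylRel f)))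

/-- The inclusion `x ↦ [(x, 0)]` of `X` as the free end of the cylinder. -/
def cylIncl (f : C(X, Y)) (x : X) : MappingCylinder f := Quot.mk (CylRel f) (Sum.inl (x, 0))

/-- The copy of `X` in `M_f`. -/
def cylBase (f : C(X, Y)) : Set (MappingCylinder f) := range (cylIncl f)

end Cylinder

/-- `Y` is an ANR (absolute neighbourhood retract for metrizable spaces): it is metrizable and, for
every closed embedding into a metrizable space, the image is a retract of an open neighbourhood. -/
structure IsANR (Y : Type v) [TopologicalSpace Y] : Prop where
  metrizable : TopologicalSpace.MetrizableSpace Y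
  nhd_retract : ∀ (Z : Type v) [TopologicalSpace Z] [TopologicalSpace.MetrizableSpace Z]
    (e : Y → Z), IsClosedEmbedding e →
    ∃ V : Set Z, IsOpen V ∧ range e ⊆ V ∧
      ∃ r : C(V, Y), ∀ (y : Y) (hy : e y ∈ V), r ⟨e y, hy⟩ = y

end MapTC

namespace MapTC

/-! Since paths depend continuously on a parameter exactly when they form a homotopy, every
invariant here except the robotic one counts open sets over which two fixed maps become homotopic
(`HomotopicOn`). Such counts are compared by pulling covers back along a continuous map
(`coverLeast_le_of_preimage`) and composing homotopies. For the mapping cylinder the input is that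
it deforms onto `Y`, with the free end `X` mapping to `Y` by `f`.

A robotic section over `C_i \ C_{i-1}`, composed with `f`, is a homotopy over a locally closed set.
The ANR hypothesis thickens this set to an open one (`HomotopicOn.exists_isOpen_of_diff`). The
necessary extension property comes from Dugundji's theorem and the Kuratowski embedding. -/

/-! ### Covering invariants as homotopies over open sets -/

theorem reducedLeast_anti {P Q : ℕ → Prop} (h : ∀ n, P n → Q n) :
    reducedLeast Q ≤ reducedLeast P :=
  le_iInf₂ fun n hn => iInf₂_le n (h n hn)

/-- The covering invariant of a property of open sets: the least `k` such that the space is covered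
by `k + 1` open sets with that property. -/
noncomputable def coverLeast {B : Type*} [TopologicalSpace B] (P : Set B → Prop) : EReal :=
  reducedLeast fun n => ∃ U : Fin n → Set B, (∀ i, IsOpen (U i) ∧ P (U i)) ∧ ⋃ i, U i = univ

theorem coverLeast_le_of_preimage {B B' : Type*} [TopologicalSpace B] [TopologicalSpace B']
    {P : Set B → Prop} {P' : Set B' → Prop} (q : C(B', B)) (h : ∀ U, P U → P' (q ⁻¹' U)) :
    coverLeast P' ≤ coverLeast P := by
  refine reducedLeast_anti fun n ⟨U, hU, hcov⟩ =>
    ⟨fun i => q ⁻¹' U i, fun i => ⟨(hU i).1.preimage q.continuous, h _ (hU i).2⟩, ?_⟩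
  rw [← preimage_iUnion, hcov, preimage_univ]

theorem coverLeast_congr {B : Type*} [TopologicalSpace B] {P Q : Set B → Prop}
    (h : ∀ U, P U ↔ Q U) : coverLeast P = coverLeast Q :=
  congrArg coverLeast (funext fun U => propext (h U))

/-- This is the exponential law; uncurrying only needs `I` locally compact, so `T` is arbitrary. -/
theorem exists_pathFamily_iff_homotopic {T Z : Type*} [TopologicalSpace T] [TopologicalSpace Z]
    (g₀ g₁ : C(T, Z)) :
    (∃ s : C(T, C(I, Z)), ∀ t, s t 0 = g₀ t ∧ s t 1 = g₁ t) ↔ g₀.Homotopic g₁ := by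
  constructor
  · rintro ⟨s, hs⟩
    exact ⟨{ toContinuousMap := s.uncurry.comp ⟨Prod.swap, continuous_swap⟩
             map_zero_left := fun t => (hs t).1
             map_one_left := fun t => (hs t).2 }⟩
  · rintro ⟨H⟩
    exact ⟨(H.toContinuousMap.comp ⟨Prod.swap, continuous_swap⟩).curry,
      fun t => ⟨H.apply_zero t, H.apply_one t⟩⟩

/-- The maps `g₀` and `g₁` are homotopic after restriction to `U`. -/
def HomotopicOn {B Z : Type*} [TopologicalSpace B] [TopologicalSpace Z] (g₀ g₁ : C(B, Z))
    (U : Set B) : Prop :=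
  (g₀.restrict U).Homotopic (g₁.restrict U)

theorem homotopicOn_iff {B Z : Type*} [TopologicalSpace B] [TopologicalSpace Z] {g₀ g₁ : C(B, Z)}
    {U : Set B} :
    HomotopicOn g₀ g₁ U ↔ ∃ s : C(U, C(I, Z)), ∀ z : U, s z 0 = g₀ z ∧ s z 1 = g₁ z :=
  (exists_pathFamily_iff_homotopic _ _).symm

namespace HomotopicOn

variable {B B' Z Z' : Type*} [TopologicalSpace B] [TopologicalSpace B'] [TopologicalSpace Z]
  [TopologicalSpace Z'] {g₀ g₁ g₂ : C(B, Z)} {U : Set B}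

theorem of_homotopic (h : g₀.Homotopic g₁) (U : Set B) : HomotopicOn g₀ g₁ U :=
  h.comp (ContinuousMap.Homotopic.refl (⟨Subtype.val, continuous_subtype_val⟩ : C(U, B)))

theorem symm (h : HomotopicOn g₀ g₁ U) : HomotopicOn g₁ g₀ U :=
  ContinuousMap.Homotopic.symm h

theorem trans (h : HomotopicOn g₀ g₁ U) (h' : HomotopicOn g₁ g₂ U) : HomotopicOn g₀ g₂ U :=
  ContinuousMap.Homotopic.trans h h'

theorem postcomp (h : HomotopicOn g₀ g₁ U) (k : C(Z, Z')) :
    HomotopicOn (k.comp g₀) (k.comp g₁) U :=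
  (ContinuousMap.Homotopic.refl k).comp h

theorem precomp (h : HomotopicOn g₀ g₁ U) (q : C(B', B)) :
    HomotopicOn (g₀.comp q) (g₁.comp q) (q ⁻¹' U) :=
  h.comp (ContinuousMap.Homotopic.refl
    (⟨fun z => ⟨q z, z.2⟩, by fun_prop⟩ : C(q ⁻¹' U, U)))

end HomotopicOn

theorem pullTC_eq_coverLeast {X Y : Type*} [TopologicalSpace X] [TopologicalSpace Y] (f : C(X, Y)) :
    pullTC f = coverLeast
      (HomotopicOn (f.comp ContinuousMap.fst : C(X × X, Y)) (f.comp ContinuousMap.snd)) :=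
  (coverLeast_congr (Q := HasPlanner f) fun _ => homotopicOn_iff).symm

theorem mixedTC_eq_coverLeast {X Y : Type*} [TopologicalSpace X] [TopologicalSpace Y]
    (f : C(X, Y)) :
    mixedTC f = coverLeast
      (HomotopicOn (ContinuousMap.fst : C(Y × X, Y)) (f.comp ContinuousMap.snd)) :=
  (coverLeast_congr (Q := HasMixedPlanner f) fun _ => homotopicOn_iff).symm

theorem relTC_eq_coverLeast {Z : Type*} [TopologicalSpace Z] (A : Set (Z × Z)) :
    relTC A = coverLeast
      (HomotopicOn (ContinuousMap.fst.restrict A) (ContinuousMap.snd.restrict A)) :=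
  (coverLeast_congr (Q := fun U : Set A => ∃ s : C(U, C(I, Z)),
    ∀ z : U, s z 0 = z.1.1.1 ∧ s z 1 = z.1.1.2) fun _ => homotopicOn_iff).symm

theorem pairTC_eq_coverLeast {Z : Type*} [TopologicalSpace Z] (A : Set Z) :
    pairTC A = coverLeast (HomotopicOn
      ((⟨Subtype.val, continuous_subtype_val⟩ : C(A, Z)).comp ContinuousMap.fst : C(A × Z, Z))
      ContinuousMap.snd) := by
  refine coverLeast_congr fun U => Iff.trans ⟨?_, ?_⟩ homotopicOn_iff.symm
  · rintro ⟨s, hs⟩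
    refine ⟨⟨fun z => (s z).1.2, by fun_prop⟩, fun z => ?_⟩
    have h := (s z).2
    -- The base component of the section is `z` itself, so the pullback condition prescribes the
    -- endpoints of its path component.
    have hz : (s z).1.1 = z.1 := hs z
    rw [hz] at h
    exact ⟨(congrArg Prod.fst h).symm, (congrArg Prod.snd h).symm⟩
  · rintro ⟨s, hs⟩
    exact ⟨⟨fun z => ⟨(z.1, s z), Prod.ext (hs z).1.symm (hs z).2.symm⟩, by fun_prop⟩,
      fun z => rfl⟩

/-! ### The mapping cylinder and its deformation onto the target -/

section Cylinder

variable {X Y : Type*} [TopologicalSpace X] [TopologicalSpace Y] (f : C(X, Y))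

/-- The quotient map from `(X × I) ⊔ Y` onto the mapping cylinder. -/
def cylMk : C((X × I) ⊕ Y, MappingCylinder f) := ⟨Quot.mk (CylRel f), continuous_quot_mk⟩

theorem cylMk_glue (x : X) : cylMk f (Sum.inl (x, 1)) = cylMk f (Sum.inr (f x)) :=
  Quot.sound (CylRel.glue x)

/-- The inclusion of the target into the mapping cylinder. -/
def cylInr : C(Y, MappingCylinder f) := (cylMk f).comp ⟨Sum.inr, continuous_inr⟩

/-- The projection of the mapping cylinder onto the target. -/
def cylProj : C(MappingCylinder f, Y) where
  toFun := Quot.lift (Sum.elim (fun p => f p.1) id) (by rintro _ _ ⟨x⟩; rfl)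
  continuous_toFun := continuous_quot_lift _ (by fun_prop)

/-- The path in the mapping cylinder from a point to its projection. -/
def cylPath : C(MappingCylinder f, C(I, MappingCylinder f)) where
  toFun := Quot.lift
    (Sum.elim
      -- With `max` the path waits at its own height and then rises to 1; from height 1 it is
      -- constant, which agrees with the constant paths on `Y`.
      (ContinuousMap.curry ⟨fun p : (X × I) × I => cylMk f (Sum.inl (p.1.1, max p.1.2 p.2)),
        by fun_prop⟩)
      (fun y => ContinuousMap.const I (cylInr f y)))
    (by
      rintro _ _ ⟨x⟩
      ext t
      change cylMk f (Sum.inl (x, max 1 t)) = cylMk f (Sum.inr (f x))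
      rw [max_eq_left unitInterval.le_one', cylMk_glue])
  continuous_toFun := continuous_quot_lift _ <| by
    refine Continuous.sumElim (ContinuousMap.continuous _) ?_
    exact ContinuousMap.continuous_const'.comp (cylInr f).continuous

theorem homotopic_cylInr_comp_cylProj :
    (ContinuousMap.id (MappingCylinder f)).Homotopic ((cylInr f).comp (cylProj f)) := by
  refine (exists_pathFamily_iff_homotopic _ _).1 ⟨cylPath f, fun m => ?_⟩
  induction m using Quot.ind with
  | mk p =>
    rcases p with ⟨x, t⟩ | y
    · refine ⟨?_, ?_⟩
      · change cylMk f (Sum.inl (x, max t 0)) = cylMk f (Sum.inl (x, t))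
        rw [max_eq_left unitInterval.nonneg']
      · change cylMk f (Sum.inl (x, max t 1)) = cylMk f (Sum.inr (f x))
        rw [max_eq_right unitInterval.le_one', cylMk_glue]
    · exact ⟨rfl, rfl⟩

theorem continuous_cylIncl : Continuous (cylIncl f) :=
  (cylMk f).continuous.comp (by fun_prop : Continuous fun x : X => (Sum.inl (x, 0) : (X × I) ⊕ Y))

/-- The part of the mapping cylinder that lies over `V` and outside of the target. -/
def cylOver (V : Set X) : Set (MappingCylinder f) :=
  {m | Quot.lift (Sum.elim (fun p => p.1 ∈ V ∧ p.2 ≠ 1) fun _ => False)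
    (by rintro _ _ ⟨x⟩; simp) m}

theorem cylIncl_mem_cylOver {V : Set X} {x : X} : cylIncl f x ∈ cylOver f V ↔ x ∈ V :=
  show x ∈ V ∧ (0 : I) ≠ 1 ↔ x ∈ V by simp

theorem isOpen_cylOver {V : Set X} (hV : IsOpen V) : IsOpen (cylOver f V) := by
  refine isOpen_coinduced.2 (isOpen_sum_iff.2 ⟨?_, isOpen_empty⟩)
  exact (hV.preimage continuous_fst).inter (isOpen_ne.preimage continuous_snd)

/-- An open `V` in `X` is the trace on the free end of the open set `cylOver f V`. Injectivity uses
the same trace for a singleton. -/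
theorem isEmbedding_cylIncl : IsEmbedding (cylIncl f) := by
  refine ⟨⟨le_antisymm (continuous_cylIncl f).le_induced fun V hV => ?_⟩, fun x x' h => ?_⟩
  · exact ⟨_, isOpen_cylOver f hV, Set.ext fun x => cylIncl_mem_cylOver f⟩
  · have hx : cylIncl f x' ∈ cylOver f {x} := h ▸ (cylIncl_mem_cylOver f).2 rfl
    exact ((cylIncl_mem_cylOver f).1 hx).symm

/-- The free end of the mapping cylinder is a copy of the source. -/
noncomputable def cylBaseHomeo : X ≃ₜ cylBase f := (isEmbedding_cylIncl f).toHomeomorph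

theorem cylIncl_cylBaseHomeo_symm (a : cylBase f) : cylIncl f ((cylBaseHomeo f).symm a) = a :=
  congrArg Subtype.val ((cylBaseHomeo f).apply_symm_apply a)

theorem homotopic_cylIncl :
    (⟨cylIncl f, continuous_cylIncl f⟩ : C(X, MappingCylinder f)).Homotopic
      ((cylInr f).comp f) :=
  (homotopic_cylInr_comp_cylProj f).comp
    (ContinuousMap.Homotopic.refl ⟨cylIncl f, continuous_cylIncl f⟩)

/-- The coordinates in `X × X` of a point of its copy in the square of the mapping cylinder. -/
noncomputable def cylCoords : C(↥(cylBase f ×ˢ cylBase f), X × X) :=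
  ⟨fun z => ((cylBaseHomeo f).symm ⟨z.1.1, z.2.1⟩, (cylBaseHomeo f).symm ⟨z.1.2, z.2.2⟩),
    by fun_prop⟩

/-- Paths in the cylinder project to `Y`, and `cylProj ∘ cylIncl = f`. Conversely, paths in `Y` are
pushed into the cylinder and spliced at both ends with the homotopy from `cylIncl` to `cylInr ∘ f`.
-/
theorem pullTC_eq_relTC : pullTC f = relTC (cylBase f ×ˢ cylBase f) := by
  rw [pullTC_eq_coverLeast, relTC_eq_coverLeast]
  apply le_antisymm
  · have hc := continuous_cylIncl f
    refine coverLeast_le_of_preimage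
      ⟨fun p => ⟨(cylIncl f p.1, cylIncl f p.2), ⟨p.1, rfl⟩, ⟨p.2, rfl⟩⟩, by fun_prop⟩ fun U h => ?_
    exact (h.postcomp (cylProj f)).precomp _
  · refine coverLeast_le_of_preimage (cylCoords f) fun U h => ?_
    have h₁ := (h.precomp (cylCoords f)).postcomp (cylInr f)
    have h₀ (q : C(↥(cylBase f ×ˢ cylBase f), X)) := HomotopicOn.of_homotopic
      ((homotopic_cylIncl f).comp (ContinuousMap.Homotopic.refl q)) (cylCoords f ⁻¹' U)
    have h₂ := ((h₀ (ContinuousMap.fst.comp (cylCoords f))).trans h₁).trans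
      (h₀ (ContinuousMap.snd.comp (cylCoords f))).symm
    convert h₂ using 1
    · ext z
      exact (cylIncl_cylBaseHomeo_symm f ⟨z.1.1, z.2.1⟩).symm
    · ext z
      exact (cylIncl_cylBaseHomeo_symm f ⟨z.1.2, z.2.2⟩).symm

theorem pullTC_le_mixedTC : pullTC f ≤ mixedTC f := by
  rw [pullTC_eq_coverLeast, mixedTC_eq_coverLeast]
  exact coverLeast_le_of_preimage (f.prodMap (ContinuousMap.id X)) fun U h => h.precomp _

theorem mixedTC_eq_pairTC : mixedTC f = pairTC (cylBase f) := by
  rw [mixedTC_eq_coverLeast, pairTC_eq_coverLeast]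
  apply le_antisymm
  · have hc := continuous_cylIncl f
    refine coverLeast_le_of_preimage
      ⟨fun p : Y × X => ((⟨cylIncl f p.2, p.2, rfl⟩ : cylBase f), cylInr f p.1), by fun_prop⟩
      fun U h => ?_
    -- The two factors occur in opposite orders in `Y × X` and `A × Z`, so paths are reversed.
    exact ((h.postcomp (cylProj f)).precomp _).symm
  · let c : C(cylBase f, X) := ⟨(cylBaseHomeo f).symm, (cylBaseHomeo f).symm.continuous⟩
    let q : C(cylBase f × MappingCylinder f, Y × X) :=
      ⟨fun p => (cylProj f p.2, c p.1), by fun_prop⟩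
    refine coverLeast_le_of_preimage q fun U h => ?_
    have h₀ := HomotopicOn.of_homotopic ((homotopic_cylIncl f).comp
      (ContinuousMap.Homotopic.refl (ContinuousMap.snd.comp q))) (q ⁻¹' U)
    have h₁ := HomotopicOn.of_homotopic ((homotopic_cylInr_comp_cylProj f).comp
      (ContinuousMap.Homotopic.refl (ContinuousMap.snd))) (q ⁻¹' U)
    have h₂ := (h₀.trans ((h.precomp q).postcomp (cylInr f)).symm).trans h₁.symm
    rw [ContinuousMap.id_comp] at h₂
    convert h₂ using 1
    ext z
    exact (cylIncl_cylBaseHomeo_symm f z.1).symm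

end Cylinder

/-! ### ANRs as neighbourhood extensors -/

/-- The Dugundji extension theorem: a map from a closed subset `K` of a metric space to a normed
space extends to the whole space, with values in the convex hull of the original values. -/
theorem exists_extension_mem_convexHull {Z E : Type*} [MetricSpace Z] [NormedAddCommGroup E]
    [NormedSpace ℝ E] {K : Set Z} (hK : IsClosed K) (hne : K.Nonempty) (g : C(K, E)) :
    ∃ G : C(Z, E), (∀ k : K, G k = g k) ∧ ∀ z, G z ∈ convexHull ℝ (range g) := by
  classical
  have hpos (z : ↥Kᶜ) : 0 < Metric.infDist z.1 K :=
    (hK.notMem_iff_infDist_pos hne).1 z.2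
  obtain ⟨F, hF⟩ := exists_continuous_forall_mem_convex_of_local_const
    (t := fun z : ↥Kᶜ => convexHull ℝ (g '' {a | dist z.1 a.1 < 2 * Metric.infDist z.1 K}))
    (fun z => convex_convexHull ℝ _) fun z => by
      -- A point `a` of `K` that is almost nearest to `z` stays admissible for all `w` near `z`, so
      -- the constant `g a` is a local selection; a partition of unity glues these.
      obtain ⟨a, ha, hza⟩ := (Metric.infDist_lt_iff hne).1
        (show Metric.infDist z.1 K < 2 * Metric.infDist z.1 K by linarith [hpos z])
      refine ⟨g ⟨a, ha⟩, ?_⟩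
      have hop : IsOpen {w : ↥Kᶜ | dist w.1 a < 2 * Metric.infDist w.1 K} :=
        isOpen_lt (by fun_prop)
          (continuous_const.mul ((Metric.continuous_infDist_pt K).comp continuous_subtype_val))
      filter_upwards [hop.mem_nhds hza] with w hw
      exact subset_convexHull ℝ _ ⟨⟨a, ha⟩, hw, rfl⟩
  let G : Z → E := fun z => if h : z ∈ K then g ⟨z, h⟩ else F ⟨z, h⟩
  have hGK (k : K) : G k = g k := dif_pos k.2
  have hGF (z : ↥Kᶜ) : G z = F z := dif_neg z.2
  have hG : Continuous G := by
    refine continuous_iff_continuousAt.2 fun z => ?_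
    by_cases hz : z ∈ K
    · rw [Metric.continuousAt_iff]
      intro ε hε
      obtain ⟨δ, hδ, hgδ⟩ := Metric.continuousAt_iff.1 (g.continuous.continuousAt (x := ⟨z, hz⟩)) ε hε
      -- The value at `w ∉ K` is a convex combination of values `g a` with `dist w a < 2 * infDist w
      -- K ≤ 2 * dist w z`, whence `dist a z < 3 * dist w z < δ`.
      refine ⟨δ / 3, by positivity, fun {w} hw => ?_⟩
      rw [hGK ⟨z, hz⟩]
      by_cases hwK : w ∈ K
      · rw [hGK ⟨w, hwK⟩]
        exact hgδ (show dist w z < δ by linarith)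
      · rw [hGF ⟨w, hwK⟩, ← Metric.mem_ball]
        refine convexHull_min ?_ (convex_ball _ _) (hF ⟨w, hwK⟩)
        rintro _ ⟨a, ha, rfl⟩
        refine hgδ (show dist a.1 z < δ from ?_)
        have h₁ : Metric.infDist w K ≤ dist w z := Metric.infDist_le_dist_of_mem hz
        have h₂ : dist w a.1 < 2 * Metric.infDist w K := ha
        linarith [dist_triangle_left a.1 z w]
    · have hF' : ContinuousOn G Kᶜ := by
        rw [continuousOn_iff_continuous_domRestrict]
        exact F.continuous.congr fun w => (hGF w).symm
      exact hF'.continuousAt (hK.isOpen_compl.mem_nhds hz)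
  refine ⟨⟨G, hG⟩, hGK, fun z => ?_⟩
  by_cases hz : z ∈ K
  · exact subset_convexHull ℝ _ ⟨⟨z, hz⟩, (hGK ⟨z, hz⟩).symm⟩
  · change G z ∈ _
    rw [hGF ⟨z, hz⟩]
    exact convexHull_mono (image_subset_range _ _) (hF ⟨z, hz⟩)

/-- The Kuratowski embedding of a pointed metric space into its bounded continuous functions. -/
noncomputable def kuratowski {Y : Type*} [MetricSpace Y] (o y : Y) :
    BoundedContinuousFunction Y ℝ :=
  BoundedContinuousFunction.ofNormedAddCommGroup (fun x => dist y x - dist o x) (by fun_prop)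
    (dist y o) fun x => abs_dist_sub_le y o x

theorem isometry_kuratowski {Y : Type*} [MetricSpace Y] (o : Y) : Isometry (kuratowski o) := by
  refine Isometry.of_dist_eq fun y z => le_antisymm ?_ ?_
  · refine (BoundedContinuousFunction.dist_le dist_nonneg).2 fun x => ?_
    change |dist y x - dist o x - (dist z x - dist o x)| ≤ _
    rw [sub_sub_sub_cancel_right]
    exact abs_dist_sub_le y z x
  · refine le_trans ?_ (BoundedContinuousFunction.dist_coe_le_dist z)
    change _ ≤ |dist y z - dist o z - (dist z z - dist o z)|
    rw [sub_sub_sub_cancel_right, dist_self, sub_zero]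
    exact le_abs_self _

/-- The Kuratowski image is closed in its convex hull. -/
theorem mem_range_kuratowski_of_mem_closure {Y : Type*} [MetricSpace Y] (o : Y)
    {g : BoundedContinuousFunction Y ℝ} (hg : g ∈ convexHull ℝ (range (kuratowski o)))
    (hcl : g ∈ closure (range (kuratowski o))) : g ∈ range (kuratowski o) := by
  -- These lower bounds hold on the Kuratowski image with `c = 1` and survive convex combinations:
  -- keep one `y` with a smaller positive `c` and drop the other nonnegative distance term. For `g`
  -- in the hull, evaluating its bound at `z` gives `c * dist y z ≤ dist g (kuratowski o z)`, so
  -- image points approaching `g` come from points `z` approaching `y`.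
  let S : Set (BoundedContinuousFunction Y ℝ) :=
    {g | ∃ y : Y, ∃ c : ℝ, 0 < c ∧ ∀ x, c * dist y x - dist o x ≤ g x}
  have hS : Convex ℝ S := by
    rintro g₁ ⟨y₁, c₁, hc₁, h₁⟩ g₂ ⟨y₂, c₂, hc₂, h₂⟩ a b ha hb hab
    rcases ha.eq_or_lt with rfl | ha'
    · obtain rfl : b = 1 := by linarith
      exact ⟨y₂, c₂, hc₂, fun x => by simpa using h₂ x⟩
    · refine ⟨y₁, a * c₁, mul_pos ha' hc₁, fun x => ?_⟩
      have e₁ := mul_le_mul_of_nonneg_left (h₁ x) ha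
      have e₂ : b * (-dist o x) ≤ b * g₂ x := mul_le_mul_of_nonneg_left
        (by linarith [h₂ x, mul_nonneg hc₂.le (dist_nonneg (x := y₂) (y := x))]) hb
      obtain rfl : b = 1 - a := by linarith
      change _ ≤ a * g₁ x + (1 - a) * g₂ x
      linarith
  have hrS : range (kuratowski o) ⊆ S := by
    rintro _ ⟨y, rfl⟩
    exact ⟨y, 1, one_pos, fun x => by rw [one_mul]; exact le_rfl⟩
  obtain ⟨y, c, hc, hgc⟩ := convexHull_min hrS hS hg
  refine ⟨y, (eq_of_forall_dist_le fun ε hε => ?_).symm⟩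
  obtain ⟨_, ⟨z, rfl⟩, hz⟩ := Metric.mem_closure_iff.1 hcl (min (ε / 2) (c * (ε / 2)))
    (by positivity)
  have hgz : g z - (dist z z - dist o z) ≤ dist g (kuratowski o z) :=
    (le_abs_self _).trans
      (BoundedContinuousFunction.dist_coe_le_dist (f := g) (g := kuratowski o z) z)
  have hyz : dist y z ≤ ε / 2 := by
    refine le_of_mul_le_mul_left ?_ hc
    have := hgc z
    rw [dist_self] at hgz
    linarith [min_le_right (ε / 2) (c * (ε / 2))]
  have htri := dist_triangle g (kuratowski o z) (kuratowski o y)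
  rw [(isometry_kuratowski o).dist_eq, dist_comm z y] at htri
  linarith [min_le_left (ε / 2) (c * (ε / 2))]

/-- An ANR is an absolute neighbourhood extensor for metrizable spaces. -/
theorem IsANR.exists_nhd_extension {Y : Type*} [TopologicalSpace Y] (hY : IsANR Y) {Z : Type*}
    [TopologicalSpace Z] [TopologicalSpace.MetrizableSpace Z] {K : Set Z} (hK : IsClosed K)
    (g : C(K, Y)) :
    ∃ N : Set Z, IsOpen N ∧ ∃ _ : K ⊆ N, ∃ G : C(N, Y), ∀ (k : K) (hk : k.1 ∈ N), G ⟨k, hk⟩ = g k := by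
  rcases K.eq_empty_or_nonempty with rfl | hne
  -- An empty `K` provides no base point for the Kuratowski embedding.
  · exact ⟨∅, isOpen_empty, subset_rfl, g, fun k => k.2.elim⟩
  have := hY.metrizable
  let := TopologicalSpace.metrizableSpaceMetric Y
  let := TopologicalSpace.metrizableSpaceMetric Z
  have o : Y := g ⟨_, hne.some_mem⟩
  let κ : C(Y, BoundedContinuousFunction Y ℝ) := ⟨kuratowski o, (isometry_kuratowski o).continuous⟩
  -- The hull lies in the universe of `Y`, as `IsANR` demands, whereas `Z` may lie in any universe.
  let H := convexHull ℝ (range (kuratowski o))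
  let e : Y → H := fun y => ⟨kuratowski o y, subset_convexHull ℝ _ ⟨y, rfl⟩⟩
  have he : Isometry e := isometry_kuratowski o
  have hcl : IsClosed (range e) := by
    refine isClosed_of_closure_subset fun h hh => ?_
    have hc : h.1 ∈ closure (range (kuratowski o)) := by
      refine map_mem_closure continuous_subtype_val hh ?_
      rintro _ ⟨y, rfl⟩
      exact ⟨y, rfl⟩
    obtain ⟨y, hy⟩ := mem_range_kuratowski_of_mem_closure o h.2 hc
    exact ⟨y, Subtype.ext hy⟩
  obtain ⟨V, hV, heV, r, hr⟩ := hY.nhd_retract H e ⟨he.isEmbedding, hcl⟩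
  obtain ⟨G, hGK, hGH⟩ := exists_extension_mem_convexHull hK hne (κ.comp g)
  let G' : C(Z, H) := ⟨fun z => ⟨G z, convexHull_mono (range_comp_subset_range _ _) (hGH z)⟩,
    by fun_prop⟩
  have hG' (k : K) : G' k = e (g k) := Subtype.ext (hGK k)
  refine ⟨G' ⁻¹' V, hV.preimage G'.continuous, fun k hk => ?_,
    r.comp ⟨fun z => ⟨G' z, z.2⟩, by fun_prop⟩, fun k hk => ?_⟩
  · exact (show G' k ∈ V from hG' ⟨k, hk⟩ ▸ heV ⟨_, rfl⟩)
  · have hV' : e (g k) ∈ V := heV ⟨_, rfl⟩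
    rw [← hr (g k) hV']
    exact congrArg r (Subtype.ext (hG' k))

/-! ### Thickening homotopies to open sets -/

/-- A homotopy over a closed set between maps into an ANR extends to an open neighbourhood. -/
theorem HomotopicOn.exists_isOpen_of_isClosed {B Y : Type*} [TopologicalSpace B]
    [TopologicalSpace.MetrizableSpace B] [TopologicalSpace Y] (hY : IsANR Y) {g₀ g₁ : C(B, Y)}
    {D : Set B} (hD : IsClosed D) (h : HomotopicOn g₀ g₁ D) :
    ∃ U, IsOpen U ∧ D ⊆ U ∧ HomotopicOn g₀ g₁ U := by
  classical
  obtain ⟨s, hs⟩ := homotopicOn_iff.1 h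
  let K₀ : Set (B × I) := {p | p.2 = 0}
  let K₁ : Set (B × I) := {p | p.2 = 1}
  let K₂ : Set (B × I) := {p | p.1 ∈ D}
  have hK₀ : IsClosed K₀ := isClosed_eq continuous_snd continuous_const
  have hK₁ : IsClosed K₁ := isClosed_eq continuous_snd continuous_const
  have hK₂ : IsClosed K₂ := hD.preimage continuous_fst
  -- The given homotopy over `D` is joined to `g₀` and `g₁` on the two ends of `B × I`; values off
  -- `K₀ ∪ K₁ ∪ K₂` play no role.
  let g : B × I → Y := fun p =>
    if h : p.1 ∈ D then s ⟨p.1, h⟩ p.2 else if p.2 = 0 then g₀ p.1 else g₁ p.1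
  have e₀ (p : B × I) (hp : p ∈ K₀) : g p = g₀ p.1 := by
    obtain ⟨b, t⟩ := p
    obtain rfl : t = 0 := hp
    by_cases hb : b ∈ D
    · simpa [g, hb] using (hs ⟨b, hb⟩).1
    · simp [g, hb]
  have e₁ (p : B × I) (hp : p ∈ K₁) : g p = g₁ p.1 := by
    obtain ⟨b, t⟩ := p
    obtain rfl : t = 1 := hp
    by_cases hb : b ∈ D
    · simpa [g, hb] using (hs ⟨b, hb⟩).2
    · simp [g, hb]
  have e₂ (p : B × I) (hp : p.1 ∈ D) : g p = s ⟨p.1, hp⟩ p.2 := dif_pos hp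
  have c₀ : ContinuousOn g K₀ :=
    (g₀.continuous.comp continuous_fst).continuousOn.congr e₀
  have c₁ : ContinuousOn g K₁ :=
    (g₁.continuous.comp continuous_fst).continuousOn.congr e₁
  have c₂ : ContinuousOn g K₂ := by
    rw [continuousOn_iff_continuous_domRestrict]
    have hc : Continuous fun p : K₂ => s.uncurry (⟨p.1.1, p.2⟩, p.1.2) :=
      s.uncurry.continuous.comp (by fun_prop)
    exact hc.congr fun p => (e₂ p.1 p.2).symm
  have hc : ContinuousOn g (K₀ ∪ K₁ ∪ K₂) :=
    (c₀.union_of_isClosed c₁ hK₀ hK₁).union_of_isClosed c₂ (hK₀.union hK₁) hK₂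
  obtain ⟨N, hN, hKN, G, hG⟩ := hY.exists_nhd_extension ((hK₀.union hK₁).union hK₂)
    ⟨_, continuousOn_iff_continuous_domRestrict.1 hc⟩
  have hG' (p : B × I) (hp : p ∈ K₀ ∪ K₁ ∪ K₂) : G ⟨p, hKN hp⟩ = g p := hG ⟨p, hp⟩ _
  -- The extended homotopy is defined over points whose whole fibre lies in `N`; compactness of `I`
  -- makes this set open.
  let U : Set B := {b | ∀ t : I, (b, t) ∈ N}
  have hU : IsOpen U := by
    refine isOpen_iff_mem_nhds.2 fun b hb => ?_
    obtain ⟨u, v, hu, hv, hbu, htv, huv⟩ := generalized_tube_lemma (isCompact_singleton (x := b))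
      (isCompact_univ (X := I)) hN (by rintro ⟨b', t⟩ ⟨rfl, _⟩; exact hb t)
    exact Filter.mem_of_superset (hu.mem_nhds (hbu rfl)) fun b' hb' t =>
      huv ⟨hb', htv (mem_univ t)⟩
  refine ⟨U, hU, fun b hb t => hKN (Or.inr hb), homotopicOn_iff.2
    ⟨ContinuousMap.curry (G.comp ⟨fun p : U × I => ⟨(p.1.1, p.2), p.1.2 p.2⟩, by fun_prop⟩),
      fun z => ⟨?_, ?_⟩⟩⟩
  · exact (hG' (z, 0) (Or.inl (Or.inl rfl))).trans (e₀ _ rfl)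
  · exact (hG' (z, 1) (Or.inl (Or.inr rfl))).trans (e₁ _ rfl)

/-- A homotopy over a difference of closed sets between maps into an ANR extends to an open
neighbourhood. -/
theorem HomotopicOn.exists_isOpen_of_diff {B Y : Type*} [TopologicalSpace B]
    [TopologicalSpace.MetrizableSpace B] [TopologicalSpace Y] (hY : IsANR Y) {g₀ g₁ : C(B, Y)}
    {C C' : Set B} (hC : IsClosed C) (hC' : IsClosed C') (h : HomotopicOn g₀ g₁ (C' \ C)) :
    ∃ U, IsOpen U ∧ C' \ C ⊆ U ∧ HomotopicOn g₀ g₁ U := by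
  -- The difference `C' \ C` is closed in the open subspace `Cᶜ`, and open sets of `Cᶜ` are open in
  -- `B`.
  let j : C(↥Cᶜ, B) := ⟨Subtype.val, continuous_subtype_val⟩
  have hj : HomotopicOn (g₀.comp j) (g₁.comp j) (j ⁻¹' C') := by
    have hpre : j ⁻¹' C' = j ⁻¹' (C' \ C) := by
      ext w
      exact ⟨fun hw => ⟨hw, w.2⟩, fun hw => hw.1⟩
    rw [hpre]
    exact h.precomp j
  obtain ⟨U, hU, hCU, hUh⟩ := hj.exists_isOpen_of_isClosed hY (hC'.preimage j.continuous)
  refine ⟨Subtype.val '' U, hC.isOpen_compl.isOpenMap_subtype_val U hU,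
    fun b hb => ⟨⟨b, hb.2⟩, hCU hb.1, rfl⟩, ?_⟩
  obtain ⟨s, hs⟩ := homotopicOn_iff.1 hUh
  have hmem (z : ↥(Subtype.val '' U)) : ∃ hz : z.1 ∈ Cᶜ, (⟨z.1, hz⟩ : ↥Cᶜ) ∈ U := by
    obtain ⟨_, w, hw, rfl⟩ := z
    exact ⟨w.2, hw⟩
  exact homotopicOn_iff.2 ⟨s.comp ⟨fun z => ⟨⟨z.1, (hmem z).1⟩, (hmem z).2⟩, by fun_prop⟩,
    fun z => hs _⟩

/-! ### Comparison with robotic complexity -/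

/-- If `f (α 0) = y` and `α 1 = x`, then `f ∘ α` runs from `y` to `f x`, so robotic sections give
mixed planners over the differences, which then thicken to open sets. -/
theorem mixedTC_le_robotTC {X Y : Type*} [TopologicalSpace X] [TopologicalSpace Y] (f : C(X, Y))
    (hX : TopologicalSpace.MetrizableSpace X) (hY : IsANR Y) : mixedTC f ≤ robotTC f := by
  have := hY.metrizable
  rw [mixedTC_eq_coverLeast]
  refine reducedLeast_anti fun n ⟨C, hC, _, hC0, hCn, hs⟩ => ?_
  have hom (i : Fin n) : HomotopicOn (ContinuousMap.fst : C(Y × X, Y))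
      (f.comp ContinuousMap.snd) (C i.succ \ C i.castSucc) := by
    obtain ⟨s, hs⟩ := hs i
    refine homotopicOn_iff.2 ⟨⟨fun z => f.comp (s z), ?_⟩, fun z => ⟨?_, ?_⟩⟩
    · exact (ContinuousMap.continuous_postcomp f).comp s.continuous
    · exact congrArg Prod.fst (hs z)
    · exact congrArg (fun p => f p.2) (hs z)
  choose U hU hCU hUh using fun i => (hom i).exists_isOpen_of_diff hY (hC i.castSucc) (hC i.succ)
  refine ⟨U, fun i => ⟨hU i, hUh i⟩, eq_univ_of_forall fun z => mem_iUnion.2 ?_⟩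
  -- The first `C i` containing `z` is not `C 0 = ∅`, so `z` lies in some difference.
  have key (i : Fin (n + 1)) : z ∈ C i → ∃ j, z ∈ U j := by
    induction i using Fin.induction with
    | zero => exact fun hz => (hC0 ▸ hz : z ∈ (∅ : Set (Y × X))).elim
    | succ i ih =>
      intro hz
      by_cases hz' : z ∈ C i.castSucc
      · exact ih hz'
      · exact ⟨i, hCU i ⟨hz, hz'⟩⟩
  exact key (Fin.last n) (hCn ▸ mem_univ z)

end MapTC

theorem mainTheorem3 {X : Type*} {Y : Type*} [TopologicalSpace X] [TopologicalSpace Y]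
    (f : C(X, Y)) :
    MapTC.pullTC f = MapTC.relTC (MapTC.cylBase f ×ˢ MapTC.cylBase f) ∧
    MapTC.relTC (MapTC.cylBase f ×ˢ MapTC.cylBase f) ≤ MapTC.mixedTC f ∧
    MapTC.mixedTC f = MapTC.pairTC (MapTC.cylBase f) ∧
    (TopologicalSpace.MetrizableSpace X → MapTC.IsANR Y →
      MapTC.pairTC (MapTC.cylBase f) ≤ MapTC.robotTC f) :=
  ⟨MapTC.pullTC_eq_relTC f, MapTC.pullTC_eq_relTC f ▸ MapTC.pullTC_le_mixedTC f,
    MapTC.mixedTC_eq_pairTC f,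
    fun hX hY => MapTC.mixedTC_eq_pairTC f ▸ MapTC.mixedTC_le_robotTC f hX hY⟩
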